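/- **Theorem 5.2.** There is a constant $\theta_0>0$ with the following property. Let $C_0>0$, and for every $\xi\in\mathbb Z^2$ let $$D(\xi)=\begin{pmatrix}\alpha(\xi)&\gamma(\xi)\\ \gamma(\xi)&\beta(\xi)\end{pmatrix}$$ be a real symmetric matrix with $\det D(\xi)=0$, $\alpha(\xi),\beta(\xi)\ge 0$ and $\alpha(\xi)+\beta(\xi)\le C_0|\xi|$, where $|\xi|$ is the Euclidean norm. Let $\nu>0$ and $\xi\in\mathbb Z^2$, and write $\alpha=\alpha(\xi)$, $\beta=\beta(\xi)$. For $t>0$ and $y,z\ge 0$ let $$R_{\xi,\tau}(t,y;z)=\int_{\Gamma}e^{\lambda t}\,e^{-\mu|y+z|}\,\frac{D(\xi)}{\nu\mu(\mu-(\alpha+\beta))}\,d\lambda,\qquad \mu=\nu^{-1/2}\sqrt{\lambda+\nu|\xi|^2}$$ (principal root) be the residual kernel of the tangential part of the Green's function for the heat equation $\partial_t\omega=\nu(\partial_z^2-|\xi|^2)\omega$ on $z>0$ with the boundary condition $\partial_z\omega+D(\xi)\omega=0$ at $z=0$. Here $\Gamma$ is any of the contours $\lambda=-\nu|\xi|^2+\nu(p^2-b^2)+2i\nu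 pb$, $b\in(-\infty,\infty)$, with $p>\alpha+\beta$, which pass to the right of $(-\infty,-\nu|\xi|^2]\cup\{\nu((\alpha+\beta)^2-|\xi|^2)\}$. Then the integral converges absolutely, and there is a decomposition $$R_{\xi,\tau}=R^{(1)}_{\xi,\tau}+R^{(2)}_{\xi,\tau}\qquad (t>0,\ y,z\ge0),$$ independent of the choice of $p$, in which both kernels are smooth in $z\in[0,\infty)$, such that, with $\mu_0=|\xi|+\nu^{-1/2}$, the following bounds hold for all $k\in\mathbb N_0$ and all $y,z\ge 0$: 1. for every $T\in\mathbb R$ and every $t>0$ such that $t\le T$ or $\nu|\xi|^2\ge 1$, $$|\partial_z^kR^{(1)}_{\xi,\tau}(t,y,z)|\le C_{1}(k,T)\;\mu_0^{k+1}e^{-\theta_0\mu_0(y+z)}\,e^{\nu((\alpha+\beta)^2-|\xi|^2)t};$$ 2. for every $t>0$ and every $0<c<\tfrac14$, and also for $c=\tfrac14$ if $k=0$, $$|\partial_z^kR^{(2)}_{\xi,\tau}(t,y,z)|\le C_{2}(k,c)\;\frac{1}{(\nu t)^{(k+1)/2}}\,e^{-c\frac{(y+z)^2}{\nu t}}\,e^{-\frac{\nu|\xi|^2t}{8}}.$$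 Here $|\cdot|$ is the largest absolute value of an entry, the derivatives at $z=0$ are one-sided, and the constants $C_1(k,T)$ and $C_2(k,c)$ depend only on the displayed arguments and on $C_0$; they do not depend on $\nu$, $\xi$ or $D$. -/

import Mathlib

open scoped ContDiff

noncomputable section

namespace StokesGreen

/-- Euclidean length `|ξ|` of a tangential frequency `ξ ∈ ℤ²`. -/
def freqNorm (ξ : Fin 2 → ℤ) : ℝ := Real.sqrt ((ξ 0 : ℝ) ^ 2 + (ξ 1 : ℝ) ^ 2)

/-- The standing hypothesis on the boundary matrix
`D(ξ) = [[α(ξ), γ(ξ)], [γ(ξ), β(ξ)]]`, required at every frequency `ξ ∈ ℤ²`. -/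
structure BoundaryHypothesis (C₀ : ℝ) (D : (Fin 2 → ℤ) → Matrix (Fin 2) (Fin 2) ℝ) : Prop where
  symm : ∀ ξ, (D ξ).IsSymm
  det_eq_zero : ∀ ξ, (D ξ).det = 0
  alpha_nonneg : ∀ ξ, 0 ≤ D ξ 0 0
  beta_nonneg : ∀ ξ, 0 ≤ D ξ 1 1
  trace_le : ∀ ξ, (D ξ).trace ≤ C₀ * freqNorm ξ

/-- `μ(λ) = ν^{-1/2} √(λ + ν|ξ|²)`, principal branch of the root, with `s = |ξ|`. -/
def muRoot (ν s : ℝ) (lam : ℂ) : ℂ :=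
  ((Real.sqrt ν : ℝ) : ℂ)⁻¹ * (lam + ((ν * s ^ 2 : ℝ) : ℂ)) ^ (1 / 2 : ℂ)

/-- The residual part of the resolvent kernel,
`e^{-μ|y+z|} D / (ν μ (μ - (α+β)))`, where `α + β = tr D` and `s = |ξ|`. -/
def resolventResidual (ν s : ℝ) (D : Matrix (Fin 2) (Fin 2) ℝ) (lam : ℂ) (y z : ℝ) :
    Matrix (Fin 2) (Fin 2) ℂ :=
  (Complex.exp (-(muRoot ν s lam) * ((|y + z| : ℝ) : ℂ)) /
      ((ν : ℂ) * muRoot ν s lam * (muRoot ν s lam - ((D.trace : ℝ) : ℂ)))) •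
    D.map (fun r : ℝ => (r : ℂ))

/-- The contour `Γ`: the parabola
`λ = -ν|ξ|² + ν(p² - b²) + 2iνpb`, `b` running from `-∞` to `∞`.
It comes from `Re λ, Im λ → -∞`, and leaves with `Re λ → -∞`, `Im λ → ∞`. For `p > α + β ≥ 0` it
stays in the complement of `(-∞, -ν|ξ|²] ∪ {ν((α+β)² - |ξ|²)}` and passes to the right of
that set. -/
def contour (ν s p b : ℝ) : ℂ :=
  ((-ν * s ^ 2 + ν * (p ^ 2 - b ^ 2) : ℝ) : ℂ) + ((2 * ν * p * b : ℝ) : ℂ) * Complex.I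

/-- The entries of the integrand of `∫_Γ e^{λt} R_λ(y,z) dλ` in the parameter of `Γ`. -/
def residualIntegrand (ν s p : ℝ) (D : Matrix (Fin 2) (Fin 2) ℝ) (t y z : ℝ) (i j : Fin 2)
    (b : ℝ) : ℂ :=
  Complex.exp (contour ν s p b * (t : ℂ)) *
    resolventResidual ν s D (contour ν s p b) y z i j * deriv (contour ν s p) b

/-- The residual kernel `R_{ξ,τ}(t,y;z) = ∫_Γ e^{λt} e^{-μ|y+z|} D / (ν μ (μ - (α+β))) dλ`,
with `s = |ξ|` and `D = D(ξ)`. -/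
def residualKernel (ν s p : ℝ) (D : Matrix (Fin 2) (Fin 2) ℝ) (t y z : ℝ) :
    Matrix (Fin 2) (Fin 2) ℂ :=
  Matrix.of fun i j => ∫ b : ℝ, residualIntegrand ν s p D t y z i j b

/-- The boundary remainder coefficient `μ₀ = |ξ| + 1/√ν`. -/
def muZero (ν s : ℝ) : ℝ := s + (Real.sqrt ν)⁻¹

/-- `∂_z^k` of the `(i,j)` entry of a matrix kernel on the closed half line `z ≥ 0`
(one-sided at `z = 0`). -/
def dz (k : ℕ) (K : ℝ → ℝ → ℝ → Matrix (Fin 2) (Fin 2) ℂ) (i j : Fin 2) (t y z : ℝ) : ℂ :=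
  iteratedDerivWithin k (fun z' : ℝ => K t y z' i j) (Set.Ici 0) z

/-- The entries of the kernel are smooth in `z ∈ [0, ∞)`, for all `t > 0` and `y ≥ 0`. -/
def SmoothInZ (K : ℝ → ℝ → ℝ → Matrix (Fin 2) (Fin 2) ℂ) : Prop :=
  ∀ (t : ℝ), 0 < t → ∀ (y : ℝ), 0 ≤ y → ∀ (i j : Fin 2),
    ContDiffOn ℝ ∞ (fun z : ℝ => K t y z i j) (Set.Ici 0)

end StokesGreen

end

open scoped ContDiff

noncomputable section

namespace StokesGreen

open MeasureTheory Set

/-! On `Γ` the root is `μ = p + ib`. With `τ = νt`, `x = y + z`, `a = α + β`, the kernel becomes `2i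
e^{-τ|ξ|²} D ∫ e^{τμ² - μx} / (μ - a) db`. Writing `1/(μ - a)` as a Laplace integral and integrating
the Gaussian in `b` first gives `2i e^{-τ|ξ|²} D` times `profile (a√τ) (x/√τ)`, free of `p`
(`residualKernel_eq_closedForm`). The function `f = profile A` solves `f' = -A f - √π e^{-X²/4}`, so
bounds on all derivatives reduce to bounds on `f`: it is at most `2π e^{A²}` times either
`e^{-X²/4}` or `e^{-AX}` for `X ≥ 0`.

No regularity in `t` is demanded, so at each time the whole kernel can be assigned to one summand.
If `a² ≤ |ξ|²/2` or `a²τ ≤ 1`, the factor `e^{-τ|ξ|²}` controls `e^{a²τ}` and the Gaussian bound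
holds (`norm_dz_le_gaussian`). Otherwise `a` is comparable to `|ξ|` and `a√τ > 1`: the factor
`e^{(a² - |ξ|²)τ}` is kept, derivatives cost powers of `a`, and decay at rate `μ₀` comes from
`e^{-AX/2}` if `ν|ξ|² ≥ 1` and from the Gaussian if `t ≤ T` (`norm_dz_le_boundaryLayer`). -/

/-- The profile `√π ∫₀^∞ e^{Av - (X+v)²/4} dv` of the residual kernel in similarity variables. -/
def profile (A X : ℝ) : ℝ :=
  Real.sqrt Real.pi * ∫ v in Ioi (0 : ℝ), Real.exp (A * v - (X + v) ^ 2 / 4)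

/-- The Gaussian `√π e^{-X²/4}`. -/
def gaussProfile (X : ℝ) : ℝ := Real.sqrt Real.pi * Real.exp (-X ^ 2 / 4)

/-! ### The profile: differential equation and smoothness. -/

theorem integrable_exp_linear_sub_sq (A : ℝ) :
    Integrable (fun w : ℝ => Real.exp (A * w - w ^ 2 / 4)) := by
  have h := ((integrable_exp_neg_mul_sq (b := 1 / 4) (by norm_num)).comp_sub_right (2 * A)).const_mul
    (Real.exp (A ^ 2))
  refine h.congr (Filter.Eventually.of_forall fun w => ?_)
  simp only [← Real.exp_add]
  congr 1; ring

theorem integral_exp_linear_sub_sq (A : ℝ) :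
    ∫ w : ℝ, Real.exp (A * w - w ^ 2 / 4) = Real.exp (A ^ 2) * (2 * Real.sqrt Real.pi) := by
  have h : ∀ w : ℝ, Real.exp (A * w - w ^ 2 / 4) =
      Real.exp (A ^ 2) * Real.exp (-(1 / 4) * (w - 2 * A) ^ 2) := fun w => by
    rw [← Real.exp_add]; congr 1; ring
  simp_rw [h]
  rw [integral_const_mul, integral_sub_right_eq_self (fun w : ℝ => Real.exp (-(1 / 4) * w ^ 2)),
    integral_gaussian]
  have : Real.pi / (1 / 4) = 2 ^ 2 * Real.pi := by ring
  rw [this, Real.sqrt_mul (by norm_num), Real.sqrt_sq (by norm_num)]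

/-- The shift `w = X + v` leaves `X` only in a prefactor and in the lower limit, so the fundamental
theorem of calculus yields the differential equation; the prefactor also shows the decay `e^{-AX}`.
-/
theorem profile_eq (A X : ℝ) :
    profile A X = Real.sqrt Real.pi * (Real.exp (-A * X) *
      ∫ w in Ioi X, Real.exp (A * w - w ^ 2 / 4)) := by
  unfold profile
  congr 1
  rw [← integral_const_mul, ← integral_indicator measurableSet_Ioi,
    ← integral_indicator measurableSet_Ioi, ← integral_sub_right_eq_self _ X]
  refine integral_congr_ae (Filter.Eventually.of_forall fun w => ?_)
  beta_reduce
  by_cases hw : X < w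
  · rw [indicator_of_mem (mem_Ioi.2 (sub_pos.2 hw)), indicator_of_mem (mem_Ioi.2 hw), ← Real.exp_add]
    congr 1; ring
  · rw [indicator_of_notMem (by simpa using hw), indicator_of_notMem (show w ∉ Ioi X from hw)]

theorem hasDerivAt_profile (A X : ℝ) :
    HasDerivAt (profile A) (-A * profile A X - gaussProfile X) X := by
  have hint := integrable_exp_linear_sub_sq A
  have hcont : Continuous (fun w : ℝ => Real.exp (A * w - w ^ 2 / 4)) := by fun_prop
  have hI : HasDerivAt (fun X => ∫ w in Ioi X, Real.exp (A * w - w ^ 2 / 4))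
      (-Real.exp (A * X - X ^ 2 / 4)) X := by
    have h1 := (intervalIntegral.integral_hasDerivAt_right (hcont.intervalIntegrable 0 X)
      (hcont.stronglyMeasurableAtFilter _ _) hcont.continuousAt).const_sub
      (∫ w in Ioi 0, Real.exp (A * w - w ^ 2 / 4))
    refine h1.congr_of_eventuallyEq (Filter.Eventually.of_forall fun Y => ?_)
    have := intervalIntegral.integral_Ioi_sub_Ioi' (a := 0) (b := Y)
      hint.integrableOn hint.integrableOn
    simp only [← this, sub_sub_cancel]
  have hE : HasDerivAt (fun X : ℝ => Real.exp (-A * X)) (Real.exp (-A * X) * (-A)) X := by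
    simpa using ((hasDerivAt_id X).const_mul (-A)).exp
  have hfun : profile A = fun X => Real.sqrt Real.pi * (Real.exp (-A * X) *
      ∫ w in Ioi X, Real.exp (A * w - w ^ 2 / 4)) := funext (profile_eq A)
  rw [profile_eq, hfun]
  refine ((hE.mul hI).const_mul (Real.sqrt Real.pi)).congr_deriv ?_
  have : Real.exp (-A * X) * Real.exp (A * X - X ^ 2 / 4) = Real.exp (-X ^ 2 / 4) := by
    rw [← Real.exp_add]; congr 1; ring
  rw [gaussProfile, ← this]; ring

theorem contDiff_gaussProfile {n : WithTop ℕ∞} : ContDiff ℝ n gaussProfile := by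
  unfold gaussProfile; fun_prop

theorem deriv_profile (A : ℝ) : deriv (profile A) = fun X => -A * profile A X - gaussProfile X :=
  funext fun X => (hasDerivAt_profile A X).deriv

/-- The differential equation bootstraps: its right-hand side is as regular as the profile itself.
-/
theorem contDiff_profile (A : ℝ) : ContDiff ℝ ∞ (profile A) := by
  refine contDiff_infty.2 fun n => ?_
  induction n with
  | zero =>
    exact contDiff_zero.2 (continuous_iff_continuousAt.2 fun X =>
      (hasDerivAt_profile A X).continuousAt)
  | succ n ih =>
    push_cast
    refine contDiff_succ_iff_deriv.2
      ⟨fun X => (hasDerivAt_profile A X).differentiableAt, by simp, ?_⟩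
    rw [deriv_profile]
    exact (contDiff_const.mul ih).sub contDiff_gaussProfile

theorem iteratedDeriv_succ_profile (k : ℕ) (A X : ℝ) :
    iteratedDeriv (k + 1) (profile A) X =
      -A * iteratedDeriv k (profile A) X - iteratedDeriv k gaussProfile X := by
  have hk : ContDiff ℝ k (profile A) := (contDiff_profile A).of_le (by exact_mod_cast le_top)
  rw [iteratedDeriv_succ', deriv_profile]
  have := iteratedDeriv_sub (n := k) (x := X) (f := fun X => -A * profile A X)
    (contDiff_const.mul hk).contDiffAt contDiff_gaussProfile.contDiffAt
  rw [iteratedDeriv_const_mul (-A) hk.contDiffAt] at this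
  exact this

/-! ### Bounds on the profile and its derivatives. -/

theorem profile_nonneg (A X : ℝ) : 0 ≤ profile A X :=
  mul_nonneg (Real.sqrt_nonneg _) (integral_nonneg fun _ => (Real.exp_pos _).le)

/-- For `X, v ≥ 0` the cross term can be dropped: `(X + v)² ≥ X² + v²`. -/
theorem profile_le_gaussian (A : ℝ) {X : ℝ} (hX : 0 ≤ X) :
    profile A X ≤ 2 * Real.pi * (Real.exp (A ^ 2) * Real.exp (-(1 / 4) * X ^ 2)) := by
  have hint := integrable_exp_linear_sub_sq A
  have h : ∫ v in Ioi (0 : ℝ), Real.exp (A * v - (X + v) ^ 2 / 4) ≤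
      Real.exp (-(1 / 4) * X ^ 2) * (Real.exp (A ^ 2) * (2 * Real.sqrt Real.pi)) := by
    rw [← integral_exp_linear_sub_sq]
    calc _ ≤ ∫ v in Ioi (0 : ℝ), Real.exp (-(1 / 4) * X ^ 2) * Real.exp (A * v - v ^ 2 / 4) := by
          refine setIntegral_mono_on₀ ?_ (hint.const_mul _).integrableOn
            measurableSet_Ioi.nullMeasurableSet fun v hv => ?_
          · have h' := ((integrable_exp_linear_sub_sq (A - X / 2)).const_mul
              (Real.exp (-X ^ 2 / 4)))
            refine (h'.congr (Filter.Eventually.of_forall fun w => ?_)).integrableOn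
            simp only [← Real.exp_add]
            congr 1; ring
          · rw [← Real.exp_add]
            have : 0 < v := hv
            refine Real.exp_le_exp.2 ?_
            nlinarith [mul_nonneg hX this.le]
      _ ≤ _ := by
          rw [integral_const_mul]
          refine mul_le_mul_of_nonneg_left ?_ (Real.exp_pos _).le
          exact setIntegral_le_integral hint
            (Filter.Eventually.of_forall fun _ => (Real.exp_pos _).le)
  calc profile A X ≤ Real.sqrt Real.pi * _ :=
        mul_le_mul_of_nonneg_left h (Real.sqrt_nonneg _)
    _ = 2 * (Real.sqrt Real.pi * Real.sqrt Real.pi) *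
        (Real.exp (A ^ 2) * Real.exp (-(1 / 4) * X ^ 2)) := by ring
    _ = _ := by rw [Real.mul_self_sqrt Real.pi_pos.le]

theorem profile_le_exp (A X : ℝ) :
    profile A X ≤ 2 * Real.pi * (Real.exp (A ^ 2) * Real.exp (-A * X)) := by
  rw [profile_eq]
  have h : ∫ w in Ioi X, Real.exp (A * w - w ^ 2 / 4) ≤
      Real.exp (A ^ 2) * (2 * Real.sqrt Real.pi) := by
    rw [← integral_exp_linear_sub_sq]
    exact setIntegral_le_integral (integrable_exp_linear_sub_sq A)
      (Filter.Eventually.of_forall fun _ => (Real.exp_pos _).le)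
  calc _ ≤ Real.sqrt Real.pi * (Real.exp (-A * X) *
        (Real.exp (A ^ 2) * (2 * Real.sqrt Real.pi))) := by gcongr
    _ = 2 * (Real.sqrt Real.pi * Real.sqrt Real.pi) *
        (Real.exp (A ^ 2) * Real.exp (-A * X)) := by ring
    _ = _ := by rw [Real.mul_self_sqrt Real.pi_pos.le]

theorem exists_polynomial_iteratedDeriv_gaussProfile (k : ℕ) :
    ∃ P : Polynomial ℝ, ∀ X, iteratedDeriv k gaussProfile X = P.eval X * Real.exp (-X ^ 2 / 4) := by
  induction k with
  | zero => exact ⟨Polynomial.C (Real.sqrt Real.pi), fun X => by simp [gaussProfile]⟩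
  | succ k ih =>
    obtain ⟨P, hP⟩ := ih
    refine ⟨Polynomial.derivative P - Polynomial.C (1 / 2) * Polynomial.X * P, fun X => ?_⟩
    rw [iteratedDeriv_succ, funext hP]
    have hE : HasDerivAt (fun X : ℝ => Real.exp (-X ^ 2 / 4))
        (Real.exp (-X ^ 2 / 4) * (-(2 * X) / 4)) X := by
      simpa using (((hasDerivAt_pow 2 X).neg).div_const 4).exp
    refine ((P.hasDerivAt X).mul hE).deriv.trans ?_
    simp only [Polynomial.eval_sub, Polynomial.eval_mul, Polynomial.eval_C, Polynomial.eval_X]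
    ring

theorem exists_polynomial_eval_le_exp_sq (P : Polynomial ℝ) {ε : ℝ} (hε : 0 < ε) :
    ∃ M : ℝ, 0 ≤ M ∧ ∀ X : ℝ, |P.eval X| ≤ M * Real.exp (ε * X ^ 2) := by
  induction P using Polynomial.induction_on' with
  | add P Q hP hQ =>
    obtain ⟨M, hM, hP⟩ := hP
    obtain ⟨N, hN, hQ⟩ := hQ
    refine ⟨M + N, add_nonneg hM hN, fun X => ?_⟩
    rw [Polynomial.eval_add, add_mul]
    exact (abs_add_le _ _).trans (add_le_add (hP X) (hQ X))
  | monomial n c =>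
    refine ⟨|c| * (n.factorial * Real.exp (1 / (4 * ε))), by positivity, fun X => ?_⟩
    rw [Polynomial.eval_monomial, abs_mul, abs_pow, mul_assoc |c|]
    refine mul_le_mul_of_nonneg_left ?_ (abs_nonneg c)
    have h1 := Real.pow_div_factorial_le_exp |X| (abs_nonneg X) n
    rw [div_le_iff₀ (by positivity)] at h1
    -- Completing the square trades the linear exponent for `εX²` plus a constant.
    have h2 : |X| ≤ 1 / (4 * ε) + ε * X ^ 2 := by
      have : 1 / (4 * ε) + ε * X ^ 2 - |X| = ε * (|X| - 1 / (2 * ε)) ^ 2 := by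
        rw [← sq_abs X]; field_simp; ring
      have h3 : 0 ≤ ε * (|X| - 1 / (2 * ε)) ^ 2 := by positivity
      linarith
    calc |X| ^ n ≤ Real.exp |X| * n.factorial := h1
      _ ≤ Real.exp (1 / (4 * ε) + ε * X ^ 2) * n.factorial := by gcongr
      _ = _ := by rw [Real.exp_add]; ring

/-- Differentiation produces polynomial factors, absorbed by giving up part of the rate `1/4`. -/
theorem exists_iteratedDeriv_gaussProfile_le (k : ℕ) {c : ℝ} (hc : c < 1 / 4) :
    ∃ M : ℝ, 0 ≤ M ∧ ∀ X, |iteratedDeriv k gaussProfile X| ≤ M * Real.exp (-c * X ^ 2) := by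
  obtain ⟨P, hP⟩ := exists_polynomial_iteratedDeriv_gaussProfile k
  obtain ⟨M, hM, hb⟩ := exists_polynomial_eval_le_exp_sq P (sub_pos.2 hc)
  refine ⟨M, hM, fun X => ?_⟩
  rw [hP, abs_mul, Real.abs_exp]
  calc _ ≤ M * Real.exp ((1 / 4 - c) * X ^ 2) * Real.exp (-X ^ 2 / 4) := by gcongr; exact hb X
    _ = _ := by rw [mul_assoc, ← Real.exp_add]; congr 2; ring

/-- A bound on `|∂^k profile|` follows from one on the profile and one on the Gaussian. -/
theorem exists_iteratedDeriv_profile_le {W : ℝ → ℝ → ℝ}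
    (h0 : ∃ N, 0 ≤ N ∧ ∀ A X, 0 ≤ A → 0 ≤ X → profile A X ≤ N * W A X)
    (hg : ∀ k, ∃ M, 0 ≤ M ∧ ∀ A X, 0 ≤ A → 0 ≤ X → |iteratedDeriv k gaussProfile X| ≤ M * W A X)
    (hW : ∀ A X, 0 ≤ W A X) (k : ℕ) :
    ∃ N, 0 ≤ N ∧ ∀ A X, 0 ≤ A → 0 ≤ X →
      |iteratedDeriv k (profile A) X| ≤ N * (1 + A) ^ k * W A X := by
  induction k with
  | zero =>
    obtain ⟨N, hN, h⟩ := h0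
    refine ⟨N, hN, fun A X hA hX => ?_⟩
    rw [iteratedDeriv_zero, abs_of_nonneg (profile_nonneg A X), pow_zero, mul_one]
    exact h A X hA hX
  | succ k ih =>
    obtain ⟨N, hN, h⟩ := ih
    obtain ⟨M, hM, h'⟩ := hg k
    refine ⟨N + M, add_nonneg hN hM, fun A X hA hX => ?_⟩
    rw [iteratedDeriv_succ_profile]
    have hWp := hW A X
    have h1 : (1 : ℝ) ≤ (1 + A) ^ (k + 1) := one_le_pow₀ (by linarith)
    calc _ ≤ |-A * iteratedDeriv k (profile A) X| + |iteratedDeriv k gaussProfile X| :=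
          abs_sub _ _
      _ ≤ (1 + A) * (N * (1 + A) ^ k * W A X) + M * (1 + A) ^ (k + 1) * W A X := by
          rw [abs_mul, abs_neg, abs_of_nonneg hA]
          gcongr
          · linarith
          · exact h A X hA hX
          · exact (h' A X hA hX).trans (by gcongr; exact le_mul_of_one_le_right hM h1)
      _ = _ := by ring

theorem exists_iteratedDeriv_profile_le_gaussian (k : ℕ) (c : ℝ)
    (hc : c < 1 / 4 ∨ (c = 1 / 4 ∧ k = 0)) :
    ∃ N, 0 ≤ N ∧ ∀ A X, 0 ≤ A → 0 ≤ X → |iteratedDeriv k (profile A) X| ≤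
      N * (1 + A) ^ k * (Real.exp (A ^ 2) * Real.exp (-c * X ^ 2)) := by
  rcases hc with hc | ⟨rfl, rfl⟩
  · refine exists_iteratedDeriv_profile_le
      (W := fun A X => Real.exp (A ^ 2) * Real.exp (-c * X ^ 2)) ?_ (fun k => ?_)
      (fun _ _ => by positivity) k
    · refine ⟨2 * Real.pi, by positivity, fun A X _ hX => (profile_le_gaussian A hX).trans ?_⟩
      gcongr
    · obtain ⟨M, hM, h⟩ := exists_iteratedDeriv_gaussProfile_le k hc
      refine ⟨M, hM, fun A X _ _ => (h X).trans ?_⟩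
      gcongr
      exact le_mul_of_one_le_left (Real.exp_pos _).le (Real.one_le_exp (by positivity))
  · refine ⟨2 * Real.pi, by positivity, fun A X _ hX => ?_⟩
    rw [iteratedDeriv_zero, abs_of_nonneg (profile_nonneg A X), pow_zero, mul_one]
    exact profile_le_gaussian A hX

/-- Halving the rate leaves room for the Gaussian source terms: `A² - AX/2 + X²/8 ≥ (X - 2A)²/8 ≥
0`. -/
theorem exists_iteratedDeriv_profile_le_exp (k : ℕ) :
    ∃ N, 0 ≤ N ∧ ∀ A X, 0 ≤ A → 0 ≤ X → |iteratedDeriv k (profile A) X| ≤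
      N * (1 + A) ^ k * (Real.exp (A ^ 2) * Real.exp (-(A * X) / 2)) := by
  refine exists_iteratedDeriv_profile_le
    (W := fun A X => Real.exp (A ^ 2) * Real.exp (-(A * X) / 2)) ?_ (fun k => ?_)
    (fun _ _ => by positivity) k
  · refine ⟨2 * Real.pi, by positivity, fun A X hA hX => (profile_le_exp A X).trans ?_⟩
    gcongr
    nlinarith [mul_nonneg hA hX]
  · obtain ⟨M, hM, h⟩ := exists_iteratedDeriv_gaussProfile_le k (c := 1 / 8) (by norm_num)
    refine ⟨M, hM, fun A X _ _ => (h X).trans ?_⟩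
    rw [← Real.exp_add]
    gcongr
    nlinarith [sq_nonneg (X - 2 * A), sq_nonneg A]

/-! ### From the contour to a vertical line in `μ`. -/

theorem contour_eq (ν s p b : ℝ) :
    contour ν s p b = (ν : ℂ) * ((p : ℂ) + b * Complex.I) ^ 2 - ((ν * s ^ 2 : ℝ) : ℂ) := by
  unfold contour
  push_cast
  ring_nf
  rw [Complex.I_sq]
  ring

theorem hasDerivAt_contour (ν s p b : ℝ) :
    HasDerivAt (contour ν s p) (2 * Complex.I * ν * ((p : ℂ) + b * Complex.I)) b := by
  rw [funext (contour_eq ν s p)]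
  have h1 : HasDerivAt (fun b : ℝ => (p : ℂ) + b * Complex.I) Complex.I b := by
    simpa using ((Complex.ofRealCLM.hasDerivAt (x := b)).mul_const Complex.I).const_add (p : ℂ)
  refine (((h1.pow 2).const_mul (ν : ℂ)).sub_const _).congr_deriv ?_
  push_cast
  ring

theorem muRoot_contour {ν p : ℝ} (hν : 0 < ν) (hp : 0 < p) (s b : ℝ) :
    muRoot ν s (contour ν s p b) = (p : ℂ) + b * Complex.I := by
  have hsq : (Real.sqrt ν : ℂ) ^ 2 = ν := by
    rw [← Complex.ofReal_pow, Real.sq_sqrt hν.le]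
  have hne : (Real.sqrt ν : ℂ) ≠ 0 := by
    exact_mod_cast (Real.sqrt_pos.2 hν).ne'
  have hpos : 0 < ((Real.sqrt ν : ℂ) * ((p : ℂ) + b * Complex.I)).re := by
    simpa using mul_pos (Real.sqrt_pos.2 hν) hp
  rw [muRoot, contour_eq, sub_add_cancel, ← hsq, ← mul_pow, one_div,
    Complex.sq_cpow_two_inv hpos, inv_mul_cancel_left₀ hne]

/-- The scalar integrand `e^{τμ² - μx} / (μ - a)` along `μ = p + ib`. -/
def lineIntegrand (τ a x p b : ℝ) : ℂ :=
  Complex.exp ((τ : ℂ) * ((p : ℂ) + b * Complex.I) ^ 2 - ((p : ℂ) + b * Complex.I) * x) /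
    (((p : ℂ) + b * Complex.I) - a)

/-- The Jacobian `2iνμ` cancels the factor `νμ` of the denominator; only the pole at `μ = a`
survives. -/
theorem residualIntegrand_eq {ν p : ℝ} (hν : 0 < ν) (hp : 0 < p) (s : ℝ)
    (D : Matrix (Fin 2) (Fin 2) ℝ) (t : ℝ) {y z : ℝ} (hy : 0 ≤ y) (hz : 0 ≤ z) (i j : Fin 2)
    (b : ℝ) :
    residualIntegrand ν s p D t y z i j b =
      (2 * Complex.I * (Real.exp (-(ν * s ^ 2 * t)) : ℂ) * (D i j : ℂ)) *
        lineIntegrand (ν * t) D.trace (y + z) p b := by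
  have hμ : (p : ℂ) + b * Complex.I ≠ 0 := fun h => hp.ne' (by simpa using congrArg Complex.re h)
  have hν' : (ν : ℂ) ≠ 0 := by exact_mod_cast hν.ne'
  rw [residualIntegrand, resolventResidual, (hasDerivAt_contour ν s p b).deriv,
    muRoot_contour hν hp, contour_eq, lineIntegrand, abs_of_nonneg (add_nonneg hy hz)]
  simp only [Matrix.smul_apply, Matrix.map_apply, smul_eq_mul]
  set m := (p : ℂ) + b * Complex.I with hm
  have e1 : Complex.exp (((ν : ℂ) * m ^ 2 - ((ν * s ^ 2 : ℝ) : ℂ)) * t) *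
      Complex.exp (-m * ((y + z : ℝ) : ℂ)) = (Real.exp (-(ν * s ^ 2 * t)) : ℂ) *
      Complex.exp (((ν * t : ℝ) : ℂ) * m ^ 2 - m * ((y + z : ℝ) : ℂ)) := by
    rw [Complex.ofReal_exp, ← Complex.exp_add, ← Complex.exp_add]
    congr 1; push_cast; ring
  calc _ = (Complex.exp (((ν : ℂ) * m ^ 2 - ((ν * s ^ 2 : ℝ) : ℂ)) * t) *
      Complex.exp (-m * ((y + z : ℝ) : ℂ))) * (D i j * (2 * Complex.I * ν * m)) /
        (ν * m * (m - D.trace)) := by ring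
    _ = _ := by
      rw [e1]
      rw [mul_assoc (ν : ℂ), div_mul_eq_div_div, div_mul_eq_div_div]
      field_simp

theorem norm_exp_line {τ x p b : ℝ} :
    ‖Complex.exp ((τ : ℂ) * ((p : ℂ) + b * Complex.I) ^ 2 - ((p : ℂ) + b * Complex.I) * x)‖ =
      Real.exp (τ * p ^ 2 - p * x) * Real.exp (-τ * b ^ 2) := by
  rw [Complex.norm_exp, ← Real.exp_add]
  congr 1
  simp [pow_two]
  ring

/-! ### Laplace representation, Fubini and the Gaussian integral. -/

/-- The integrand obtained from `1 / (μ - a) = ∫₀^∞ e^{-(μ-a)u} du`. -/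
def laplaceIntegrand (τ a x p b u : ℝ) : ℂ :=
  Complex.exp ((τ : ℂ) * ((p : ℂ) + b * Complex.I) ^ 2 - ((p : ℂ) + b * Complex.I) * x) *
    Complex.exp (((a : ℂ) - ((p : ℂ) + b * Complex.I)) * u)

theorem integrable_laplaceIntegrand {τ a p : ℝ} (hτ : 0 < τ) (hp : a < p) (x : ℝ) :
    Integrable (Function.uncurry (laplaceIntegrand τ a x p))
      (volume.prod (volume.restrict (Ioi 0))) := by
  have h1 : Integrable (fun b : ℝ => Real.exp (τ * p ^ 2 - p * x) * Real.exp (-τ * b ^ 2)) :=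
    (integrable_exp_neg_mul_sq hτ).const_mul _
  have h2 : Integrable (fun u : ℝ => Real.exp ((a - p) * u)) (volume.restrict (Ioi 0)) :=
    integrableOn_exp_mul_Ioi (by linarith) 0
  refine (h1.mul_prod h2).mono' ?_ (Filter.Eventually.of_forall fun q => ?_)
  · refine Continuous.aestronglyMeasurable ?_
    unfold laplaceIntegrand Function.uncurry
    fun_prop
  · simp only [Function.uncurry, laplaceIntegrand]
    rw [norm_mul, norm_exp_line, Complex.norm_exp]
    apply le_of_eq
    congr 2
    simp

theorem integral_laplaceIntegrand_right {a p : ℝ} (hp : a < p) (τ x b : ℝ) :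
    ∫ u in Ioi (0 : ℝ), laplaceIntegrand τ a x p b u = lineIntegrand τ a x p b := by
  unfold laplaceIntegrand lineIntegrand
  rw [integral_const_mul, integral_exp_mul_complex_Ioi (by simpa using hp)]
  rw [Complex.ofReal_zero, mul_zero, Complex.exp_zero, neg_div, ← div_neg, neg_sub, mul_one_div]

theorem integrable_lineIntegrand {τ a p : ℝ} (hτ : 0 < τ) (hp : a < p) (x : ℝ) :
    Integrable (lineIntegrand τ a x p) := by
  have h := (integrable_laplaceIntegrand hτ hp x).integral_prod_left
  refine h.congr (Filter.Eventually.of_forall fun b => ?_)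
  exact integral_laplaceIntegrand_right hp τ x b

theorem integral_laplaceIntegrand_left {τ : ℝ} (hτ : 0 < τ) (a x p u : ℝ) :
    ∫ b : ℝ, laplaceIntegrand τ a x p b u =
      ((Real.sqrt (Real.pi / τ) * Real.exp (a * u - (x + u) ^ 2 / (4 * τ)) : ℝ) : ℂ) := by
  have hτ' : (τ : ℂ) ≠ 0 := by exact_mod_cast hτ.ne'
  have h : ∀ b : ℝ, laplaceIntegrand τ a x p b u =
      Complex.exp ((τ * p ^ 2 - p * (x + u) + a * u : ℝ) : ℂ) *
      (Complex.exp (Complex.I * ((2 * τ * p - (x + u) : ℝ) : ℂ) * b) *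
        Complex.exp (-(τ : ℂ) * (b : ℂ) ^ 2)) := fun b => by
    rw [laplaceIntegrand, ← Complex.exp_add, ← Complex.exp_add, ← Complex.exp_add]
    congr 1
    push_cast
    ring_nf
    rw [Complex.I_sq]
    ring
  simp_rw [h]
  rw [integral_const_mul, fourierIntegral_gaussian (by simpa using hτ), mul_left_comm,
    ← Complex.exp_add]
  have hs : ((Real.pi : ℂ) / τ) ^ (1 / 2 : ℂ) = ((Real.sqrt (Real.pi / τ) : ℝ) : ℂ) := by
    rw [Real.sqrt_eq_rpow, Complex.ofReal_cpow (by positivity)]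
    push_cast; rfl
  rw [hs]
  push_cast
  congr 2
  field_simp
  ring

theorem integral_lineIntegrand {r a p : ℝ} (hr : 0 < r) (hp : a < p) (x : ℝ) :
    ∫ b : ℝ, lineIntegrand (r ^ 2) a x p b = ((profile (a * r) (x / r) : ℝ) : ℂ) := by
  have hr2 : 0 < r ^ 2 := by positivity
  simp_rw [← integral_laplaceIntegrand_right hp]
  rw [integral_integral_swap (integrable_laplaceIntegrand hr2 hp x)]
  simp_rw [integral_laplaceIntegrand_left hr2]
  rw [integral_complex_ofReal]
  congr 1
  rw [integral_const_mul, profile, Real.sqrt_div Real.pi_pos.le, Real.sqrt_sq hr.le,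
    div_mul_eq_mul_div, mul_div_assoc]
  congr 1
  -- Similarity scaling `u = r v`; its Jacobian cancels the `1/r` from `√(π/r²)`.
  have h := integral_comp_mul_left_Ioi
    (fun u => Real.exp (a * u - (x + u) ^ 2 / (4 * r ^ 2))) 0 hr
  rw [mul_zero, smul_eq_mul] at h
  rw [div_eq_inv_mul, ← h]
  congr 1
  funext v
  congr 1
  field_simp

theorem integrable_residualIntegrand {ν p : ℝ} (hν : 0 < ν) (s : ℝ)
    {D : Matrix (Fin 2) (Fin 2) ℝ} (hD : 0 ≤ D.trace) (hp : D.trace < p) {t y z : ℝ} (ht : 0 < t)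
    (hy : 0 ≤ y) (hz : 0 ≤ z) (i j : Fin 2) :
    Integrable (residualIntegrand ν s p D t y z i j) := by
  rw [funext (residualIntegrand_eq hν (hD.trans_lt hp) s D t hy hz i j)]
  exact (integrable_lineIntegrand (mul_pos hν ht) hp _).const_mul _

/-! ### Closed form, splitting in time, derivatives in `z`. -/

/-- The closed form of the residual kernel, for all real `y` and `z`. -/
def residualClosedForm (ν s : ℝ) (D : Matrix (Fin 2) (Fin 2) ℝ) (t y z : ℝ) :
    Matrix (Fin 2) (Fin 2) ℂ :=
  Matrix.of fun i j => (2 * Complex.I * (Real.exp (-(ν * s ^ 2 * t)) : ℂ) * (D i j : ℂ)) *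
    ((profile (D.trace * Real.sqrt (ν * t)) ((y + z) / Real.sqrt (ν * t)) : ℝ) : ℂ)

theorem residualKernel_eq_closedForm {ν p : ℝ} (hν : 0 < ν) (s : ℝ)
    {D : Matrix (Fin 2) (Fin 2) ℝ} (hD : 0 ≤ D.trace) (hp : D.trace < p) {t y z : ℝ} (ht : 0 < t)
    (hy : 0 ≤ y) (hz : 0 ≤ z) :
    residualKernel ν s p D t y z = residualClosedForm ν s D t y z := by
  ext i j
  simp only [residualKernel, residualClosedForm, Matrix.of_apply]
  rw [← integral_lineIntegrand (Real.sqrt_pos.2 (mul_pos hν ht)) hp,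
    Real.sq_sqrt (mul_pos hν ht).le, ← integral_const_mul]
  exact congrArg _ (funext (residualIntegrand_eq hν (hD.trans_lt hp) s D t hy hz i j))

/-- The closed form of the residual kernel switched on at the times in `S`. -/
def timePart (S : Set ℝ) (ν s : ℝ) (D : Matrix (Fin 2) (Fin 2) ℝ) (t y z : ℝ) :
    Matrix (Fin 2) (Fin 2) ℂ :=
  S.indicator (fun t => residualClosedForm ν s D t y z) t

theorem timePart_compl_add (S : Set ℝ) (ν s : ℝ) (D : Matrix (Fin 2) (Fin 2) ℝ) (t y z : ℝ) :
    timePart Sᶜ ν s D t y z + timePart S ν s D t y z = residualClosedForm ν s D t y z :=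
  congrFun (indicator_compl_add_self S fun t => residualClosedForm ν s D t y z) t

theorem contDiff_residualClosedForm (ν s : ℝ) (D : Matrix (Fin 2) (Fin 2) ℝ) (t y : ℝ)
    (i j : Fin 2) : ContDiff ℝ ∞ (fun z => residualClosedForm ν s D t y z i j) := by
  simp only [residualClosedForm, Matrix.of_apply]
  refine contDiff_const.mul (Complex.ofRealCLM.contDiff.comp
    ((contDiff_profile _).comp ?_))
  fun_prop

theorem smoothInZ_timePart (S : Set ℝ) (ν s : ℝ) (D : Matrix (Fin 2) (Fin 2) ℝ) :
    SmoothInZ (timePart S ν s D) := by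
  intro t _ y _ i j
  by_cases ht : t ∈ S
  · simp only [timePart, indicator_of_mem ht]
    exact (contDiff_residualClosedForm ν s D t y i j).contDiffOn
  · simp only [timePart, indicator_of_notMem ht]
    exact contDiffOn_const

theorem iteratedDeriv_const_mul_ofReal_comp_affine {f : ℝ → ℝ} (hf : ContDiff ℝ ∞ f) (w : ℂ)
    (y r : ℝ) (k : ℕ) :
    iteratedDeriv k (fun z : ℝ => w * ((f ((y + z) / r) : ℝ) : ℂ)) =
      fun z => w * ((iteratedDeriv k f ((y + z) / r) / r ^ k : ℝ) : ℂ) := by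
  induction k with
  | zero => simp
  | succ k ih =>
    rw [iteratedDeriv_succ, ih]
    funext z
    have h1 : HasDerivAt (iteratedDeriv k f) (iteratedDeriv (k + 1) f ((y + z) / r))
        ((y + z) / r) := by
      rw [iteratedDeriv_succ]
      exact ((hf.differentiable_iteratedDeriv k (by exact_mod_cast WithTop.coe_lt_top _))
        _).hasDerivAt
    have h2 : HasDerivAt (fun z => (y + z) / r) (1 / r) z :=
      ((hasDerivAt_id z).const_add y).div_const r
    refine ((((h1.comp z h2).div_const (r ^ k)).ofReal_comp).const_mul w).deriv.trans ?_
    congr 2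
    rw [pow_succ', ← div_div, mul_one_div]

theorem norm_dz_residualClosedForm {ν t : ℝ} (hν : 0 < ν) (ht : 0 < t) (s : ℝ)
    (D : Matrix (Fin 2) (Fin 2) ℝ) (k : ℕ) (i j : Fin 2) (y : ℝ) {z : ℝ} (hz : 0 ≤ z) :
    ‖dz k (residualClosedForm ν s D) i j t y z‖ =
      2 * Real.exp (-(ν * s ^ 2 * t)) * |D i j| *
        (|iteratedDeriv k (profile (D.trace * Real.sqrt (ν * t))) ((y + z) / Real.sqrt (ν * t))| /
          Real.sqrt (ν * t) ^ k) := by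
  have hr := Real.sqrt_pos.2 (mul_pos hν ht)
  -- The closed form is smooth across `z = 0`, so one-sided derivatives are ordinary ones.
  rw [dz, iteratedDerivWithin_eq_iteratedDeriv (uniqueDiffOn_Ici 0)
    (((contDiff_residualClosedForm ν s D t y i j).of_le (by exact_mod_cast le_top)).contDiffAt)
    hz]
  simp only [residualClosedForm, Matrix.of_apply]
  rw [iteratedDeriv_const_mul_ofReal_comp_affine (contDiff_profile _)]
  simp only [norm_mul, Complex.norm_real, Real.norm_eq_abs, Complex.norm_I, abs_div, abs_pow,
    Complex.norm_two, mul_one, Real.abs_exp, abs_of_pos hr]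

theorem dz_timePart_of_mem {S : Set ℝ} {t : ℝ} (ht : t ∈ S) (ν s : ℝ)
    (D : Matrix (Fin 2) (Fin 2) ℝ) (k : ℕ) (i j : Fin 2) (y z : ℝ) :
    dz k (timePart S ν s D) i j t y z = dz k (residualClosedForm ν s D) i j t y z := by
  simp only [dz, timePart, indicator_of_mem ht]

theorem dz_timePart_of_notMem {S : Set ℝ} {t : ℝ} (ht : t ∉ S) (ν s : ℝ)
    (D : Matrix (Fin 2) (Fin 2) ℝ) (k : ℕ) (i j : Fin 2) (y z : ℝ) :
    dz k (timePart S ν s D) i j t y z = 0 := by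
  simp only [dz, timePart, indicator_of_notMem ht, Matrix.zero_apply]
  simp

/-! ### Consequences of the hypothesis on `D`. -/

theorem freqNorm_nonneg (ξ : Fin 2 → ℤ) : 0 ≤ freqNorm ξ := Real.sqrt_nonneg _

theorem BoundaryHypothesis.trace_nonneg {C₀ : ℝ} {D : (Fin 2 → ℤ) → Matrix (Fin 2) (Fin 2) ℝ}
    (h : BoundaryHypothesis C₀ D) (ξ : Fin 2 → ℤ) : 0 ≤ (D ξ).trace := by
  rw [Matrix.trace_fin_two]
  exact add_nonneg (h.alpha_nonneg ξ) (h.beta_nonneg ξ)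

theorem BoundaryHypothesis.abs_entry_le_trace {C₀ : ℝ}
    {D : (Fin 2 → ℤ) → Matrix (Fin 2) (Fin 2) ℝ} (h : BoundaryHypothesis C₀ D) (ξ : Fin 2 → ℤ)
    (i j : Fin 2) : |D ξ i j| ≤ (D ξ).trace := by
  have hα := h.alpha_nonneg ξ
  have hβ := h.beta_nonneg ξ
  have hs : D ξ 1 0 = D ξ 0 1 := (h.symm ξ).apply 0 1
  have hd := h.det_eq_zero ξ
  rw [Matrix.det_fin_two, hs] at hd
  -- The vanishing determinant gives `γ² = αβ ≤ (α + β)²`.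
  have hγ : |D ξ 0 1| ≤ D ξ 0 0 + D ξ 1 1 :=
    abs_le_of_sq_le_sq (by nlinarith [mul_nonneg hα hβ]) (add_nonneg hα hβ)
  rw [Matrix.trace_fin_two]
  fin_cases i <;> fin_cases j
  · simpa [abs_of_nonneg hα] using hβ
  · exact hγ
  · simpa [hs] using hγ
  · simpa [abs_of_nonneg hβ] using hα

/-! ### The Gaussian regime. -/

/-- The times at which the whole residual kernel obeys the Gaussian bound. -/
def gaussianTimes (ν s a : ℝ) : Set ℝ := {t | a ^ 2 ≤ s ^ 2 / 2 ∨ a ^ 2 * (ν * t) ≤ 1}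

/-- The rate `3/8 = 1/2 - 1/8` is what `e^{-S²/2}` can spare while keeping `e^{-S²/8}`. -/
theorem one_add_pow_le_exp_sq (n : ℕ) {S : ℝ} (hS : 0 ≤ S) :
    (1 + S) ^ n ≤ n.factorial * Real.exp 2 * Real.exp (3 / 8 * S ^ 2) := by
  have h := Real.pow_div_factorial_le_exp (1 + S) (by linarith) n
  rw [div_le_iff₀ (by positivity)] at h
  calc _ ≤ Real.exp (1 + S) * n.factorial := h
    _ ≤ Real.exp (2 + 3 / 8 * S ^ 2) * n.factorial := by
        refine mul_le_mul_of_nonneg_right (Real.exp_le_exp.2 ?_) (Nat.cast_nonneg _)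
        nlinarith [sq_nonneg (S - 4 / 3)]
    _ = _ := by rw [Real.exp_add]; ring

/-- The coefficients `a e^{-s²τ}` and `e^{a²τ}` are absorbed into `τ^{-1/2} e^{-s²τ/8}`. -/
theorem exp_sq_coefficient_le {C₀ A S : ℝ} (hC : 0 < C₀) (hA : 0 ≤ A) (hS : 0 ≤ S)
    (hAS : A ≤ C₀ * S) (h : A ^ 2 ≤ S ^ 2 / 2 ∨ A ^ 2 ≤ 1) (k : ℕ) :
    A * (1 + A) ^ k * (Real.exp (-S ^ 2) * Real.exp (A ^ 2)) ≤
      (1 + C₀) ^ (k + 1) * ((k + 1).factorial * Real.exp 2) * Real.exp 1 *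
        Real.exp (-S ^ 2 / 8) := by
  have h1 : Real.exp (-S ^ 2) * Real.exp (A ^ 2) ≤ Real.exp 1 * Real.exp (-S ^ 2 / 2) := by
    rw [← Real.exp_add, ← Real.exp_add]
    refine Real.exp_le_exp.2 ?_
    rcases h with h | h <;> nlinarith [sq_nonneg S]
  have h2 : A * (1 + A) ^ k ≤ (1 + C₀) ^ (k + 1) * (1 + S) ^ (k + 1) := by
    rw [← mul_pow, pow_succ' _ k]
    have h3 : 1 + A ≤ (1 + C₀) * (1 + S) := by nlinarith
    gcongr
    linarith
  calc _ ≤ (1 + C₀) ^ (k + 1) *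
        ((k + 1).factorial * Real.exp 2 * Real.exp (3 / 8 * S ^ 2)) *
        (Real.exp 1 * Real.exp (-S ^ 2 / 2)) := by
        refine mul_le_mul (h2.trans ?_) h1 (by positivity) (by positivity)
        gcongr
        exact one_add_pow_le_exp_sq (k + 1) hS
    _ = (1 + C₀) ^ (k + 1) * ((k + 1).factorial * Real.exp 2) * Real.exp 1 *
        (Real.exp (3 / 8 * S ^ 2) * Real.exp (-S ^ 2 / 2)) := by ring
    _ = _ := by rw [← Real.exp_add]; congr 2; ring

theorem norm_dz_le_gaussian {C₀ c N : ℝ} {k : ℕ} (hC : 0 < C₀) (hN : 0 ≤ N)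
    (hprof : ∀ A X, 0 ≤ A → 0 ≤ X → |iteratedDeriv k (profile A) X| ≤
      N * (1 + A) ^ k * (Real.exp (A ^ 2) * Real.exp (-c * X ^ 2)))
    {ν s t y z : ℝ} {D : Matrix (Fin 2) (Fin 2) ℝ} (hν : 0 < ν) (hs : 0 ≤ s)
    (ha : 0 ≤ D.trace) (has : D.trace ≤ C₀ * s) {i j : Fin 2} (hD : |D i j| ≤ D.trace)
    (ht : 0 < t) (hmem : t ∈ gaussianTimes ν s D.trace) (hy : 0 ≤ y) (hz : 0 ≤ z) :
    ‖dz k (residualClosedForm ν s D) i j t y z‖ ≤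
      2 * N * ((1 + C₀) ^ (k + 1) * ((k + 1).factorial * Real.exp 2) * Real.exp 1)
        * (1 / (ν * t) ^ (((k : ℝ) + 1) / 2))
        * Real.exp (-c * ((y + z) ^ 2 / (ν * t))) * Real.exp (-(ν * s ^ 2 * t) / 8) := by
  have hτ : 0 < ν * t := mul_pos hν ht
  rw [norm_dz_residualClosedForm hν ht s D k i j y hz]
  set r := Real.sqrt (ν * t) with hr
  have hr0 : 0 < r := Real.sqrt_pos.2 hτ
  have hr2 : r ^ 2 = ν * t := Real.sq_sqrt hτ.le
  set a := D.trace with ha'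
  have hpow : (ν * t) ^ (((k : ℝ) + 1) / 2) = r ^ (k + 1) := by
    rw [← hr2, ← Real.rpow_natCast r 2, ← Real.rpow_mul hr0.le, ← Real.rpow_natCast r (k + 1)]
    congr 1; push_cast; ring
  have hX : 0 ≤ (y + z) / r := by positivity
  have hcoef := exp_sq_coefficient_le (A := a * r) (S := s * r) hC (by positivity) (by positivity)
    (by nlinarith) (by
      rcases hmem with h | h
      · left; rw [mul_pow, mul_pow]; nlinarith [sq_nonneg r]
      · right; rwa [mul_pow, hr2]) k
  have e1 : ν * s ^ 2 * t = (s * r) ^ 2 := by rw [mul_pow, hr2]; ring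
  have e2 : (y + z) ^ 2 / (ν * t) = ((y + z) / r) ^ 2 := by rw [div_pow, hr2]
  rw [hpow, e1, e2]
  calc _ ≤ 2 * Real.exp (-(s * r) ^ 2) * a * (N * (1 + a * r) ^ k *
        (Real.exp ((a * r) ^ 2) * Real.exp (-c * ((y + z) / r) ^ 2)) / r ^ k) := by
        gcongr
        exact hprof _ _ (by positivity) hX
    -- Writing `a = (a r)/r` supplies the last power in `r^{-(k+1)}`.
    _ = 2 * N * (a * r * (1 + a * r) ^ k * (Real.exp (-(s * r) ^ 2) * Real.exp ((a * r) ^ 2))) *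
        (1 / r ^ (k + 1)) * Real.exp (-c * ((y + z) / r) ^ 2) := by
        field_simp
        ring
    _ ≤ 2 * N * ((1 + C₀) ^ (k + 1) * ((k + 1).factorial * Real.exp 2) * Real.exp 1 *
        Real.exp (-(s * r) ^ 2 / 8)) *
        (1 / r ^ (k + 1)) * Real.exp (-c * ((y + z) / r) ^ 2) := by gcongr
    _ = _ := by ring

/-! ### The boundary-layer regime. -/

/-- If `ν s² ≥ 1`, then `1/√ν ≤ s ≤ 3a/2`, so `μ₀ ≤ 3a` and `e^{-ax/2}` suffices. Otherwise `s ≤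
1/√ν`, so with `X = x/r` one has `μ₀ x ≤ 2X√t ≤ X² + t`, and `e^{t/8}` is at most `e^{|T|}`. -/
theorem exp_decay_le_exp_muZero {ν s a r t T x : ℝ} (hν : 0 < ν) (hs : 0 ≤ s) (ha : 0 ≤ a)
    (hsa : s ^ 2 / 2 ≤ a ^ 2) (ht : 0 < t) (hr : 0 < r) (hr2 : r ^ 2 = ν * t) (hx : 0 ≤ x)
    (hT : t ≤ T ∨ 1 ≤ ν * s ^ 2) :
    Real.exp (-(a * r * (x / r)) / 2) ≤ Real.exp |T| * Real.exp (-(1 / 8) * muZero ν s * x) ∨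
      Real.exp (-(1 / 8) * (x / r) ^ 2) ≤
        Real.exp |T| * Real.exp (-(1 / 8) * muZero ν s * x) := by
  set n := Real.sqrt ν with hn
  have hn0 : 0 < n := Real.sqrt_pos.2 hν
  have hn2 : n ^ 2 = ν := Real.sq_sqrt hν.le
  simp_rw [← Real.exp_add]
  unfold muZero
  rw [← hn]
  by_cases h1 : 1 ≤ ν * s ^ 2
  · left
    have h2 : 1 ≤ n * s := by
      rw [← hn2, ← mul_pow] at h1
      nlinarith [mul_nonneg hn0.le hs]
    have h3 : n⁻¹ ≤ s := by
      rw [inv_le_iff_one_le_mul₀ hn0]; linarith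
    have h4 : s ≤ 3 / 2 * a := by nlinarith
    have h5 : a * r * (x / r) = a * x := by field_simp
    refine Real.exp_le_exp.2 ?_
    rw [h5]
    nlinarith [mul_nonneg (by linarith : 0 ≤ 3 * a - (s + n⁻¹)) hx, abs_nonneg T, mul_nonneg ha hx]
  · right
    have hT' : t ≤ T := hT.resolve_right h1
    have h2 : s * n ≤ 1 := by
      rw [← hn2, ← mul_pow] at h1
      nlinarith [mul_nonneg hn0.le hs]
    have h3 : s ≤ n⁻¹ := by rwa [← one_div, le_div_iff₀ hn0]
    have h4 : x / r = n⁻¹ * x / Real.sqrt t := by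
      have : r = n * Real.sqrt t := by
        rw [hn, ← Real.sqrt_mul hν.le, ← hr2, Real.sqrt_sq hr.le]
      rw [this]; field_simp
    have h5 : Real.sqrt t ^ 2 = t := Real.sq_sqrt ht.le
    have h6 : 0 < Real.sqrt t := Real.sqrt_pos.2 ht
    have h7 : x / r * Real.sqrt t = n⁻¹ * x := by rw [h4]; field_simp
    refine Real.exp_le_exp.2 ?_
    have h8 : (s + n⁻¹) * x ≤ 2 * (x / r * Real.sqrt t) := by
      rw [h7]; nlinarith
    nlinarith [sq_nonneg (x / r - Real.sqrt t), le_abs_self T]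

theorem norm_dz_le_boundaryLayer {C₀ N N' : ℝ} {k : ℕ} (hC : 0 < C₀) (hN : 0 ≤ N) (hN' : 0 ≤ N')
    (hexp : ∀ A X, 0 ≤ A → 0 ≤ X → |iteratedDeriv k (profile A) X| ≤
      N * (1 + A) ^ k * (Real.exp (A ^ 2) * Real.exp (-(A * X) / 2)))
    (hgauss : ∀ A X, 0 ≤ A → 0 ≤ X → |iteratedDeriv k (profile A) X| ≤
      N' * (1 + A) ^ k * (Real.exp (A ^ 2) * Real.exp (-(1 / 8) * X ^ 2)))
    {ν s t T y z : ℝ} {D : Matrix (Fin 2) (Fin 2) ℝ} (hν : 0 < ν) (hs : 0 ≤ s)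
    (ha : 0 ≤ D.trace) (has : D.trace ≤ C₀ * s) {i j : Fin 2} (hD : |D i j| ≤ D.trace)
    (ht : 0 < t) (hmem : t ∉ gaussianTimes ν s D.trace) (hT : t ≤ T ∨ 1 ≤ ν * s ^ 2)
    (hy : 0 ≤ y) (hz : 0 ≤ z) :
    ‖dz k (residualClosedForm ν s D) i j t y z‖ ≤
      2 * (N + N') * 2 ^ k * C₀ ^ (k + 1) * Real.exp |T| * muZero ν s ^ (k + 1)
        * Real.exp (-(1 / 8) * muZero ν s * (y + z))
        * Real.exp (ν * (D.trace ^ 2 - s ^ 2) * t) := by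
  have hτ : 0 < ν * t := mul_pos hν ht
  rw [norm_dz_residualClosedForm hν ht s D k i j y hz]
  set r := Real.sqrt (ν * t) with hr
  have hr0 : 0 < r := Real.sqrt_pos.2 hτ
  have hr2 : r ^ 2 = ν * t := Real.sq_sqrt hτ.le
  set a := D.trace with ha'
  have hsa : s ^ 2 / 2 < a ^ 2 := not_le.1 (not_or.1 hmem).1
  have har : 1 < a ^ 2 * (ν * t) := not_le.1 (not_or.1 hmem).2
  have hA : 0 ≤ a * r := by positivity
  have hA1 : 1 ≤ a * r := by
    rw [← hr2, ← mul_pow] at har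
    nlinarith
  have hX : 0 ≤ (y + z) / r := by positivity
  have hμ : s ≤ muZero ν s := le_add_of_nonneg_right (by positivity)
  set E := Real.exp |T| * Real.exp (-(1 / 8) * muZero ν s * (y + z)) with hE
  have hprof : |iteratedDeriv k (profile (a * r)) ((y + z) / r)| ≤
      (N + N') * (1 + a * r) ^ k * (Real.exp ((a * r) ^ 2) * E) := by
    rcases exp_decay_le_exp_muZero (r := r) hν hs ha hsa.le ht hr0 hr2 (add_nonneg hy hz) hT
      with h | h
    · refine (hexp _ _ hA hX).trans ?_
      gcongr
      linarith
    · refine (hgauss _ _ hA hX).trans ?_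
      gcongr
      linarith
  have haμ : a ≤ C₀ * muZero ν s := has.trans (by gcongr)
  have e1 : Real.exp (ν * (a ^ 2 - s ^ 2) * t) =
      Real.exp (-(ν * s ^ 2 * t)) * Real.exp ((a * r) ^ 2) := by
    rw [← Real.exp_add, mul_pow, hr2]; congr 1; ring
  -- Since `a r ≥ 1`, `1 + a r ≤ 2 a r`; the powers of `r` then cancel, leaving `a^{k+1}`.
  calc _ ≤ 2 * Real.exp (-(ν * s ^ 2 * t)) * a * ((N + N') * (a * r + a * r) ^ k *
        (Real.exp ((a * r) ^ 2) * E) / r ^ k) := by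
        gcongr
        refine hprof.trans ?_
        gcongr
    _ = 2 * (N + N') * 2 ^ k * a ^ (k + 1) * E * Real.exp (ν * (a ^ 2 - s ^ 2) * t) := by
        rw [e1, ← two_mul, mul_pow, mul_pow]
        field_simp
        ring
    _ ≤ 2 * (N + N') * 2 ^ k * (C₀ * muZero ν s) ^ (k + 1) * E *
        Real.exp (ν * (a ^ 2 - s ^ 2) * t) := by gcongr
    _ = _ := by rw [mul_pow, hE]; ring

end StokesGreen

end

theorem theorem5p2 :
    ∃ θ₀ : ℝ, 0 < θ₀ ∧ ∀ C₀ : ℝ, 0 < C₀ →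
      ∃ (C₁ : ℕ → ℝ → ℝ) (C₂ : ℕ → ℝ → ℝ),
        ∀ (D : (Fin 2 → ℤ) → Matrix (Fin 2) (Fin 2) ℝ), StokesGreen.BoundaryHypothesis C₀ D →
        ∀ (ν : ℝ), 0 < ν → ∀ (ξ : Fin 2 → ℤ),
        -- absolute convergence of the contour integral
        (∀ (p : ℝ), (D ξ).trace < p → ∀ (t : ℝ), 0 < t → ∀ (y z : ℝ), 0 ≤ y → 0 ≤ z →
          ∀ (i j : Fin 2), MeasureTheory.Integrable
            (StokesGreen.residualIntegrand ν (StokesGreen.freqNorm ξ) p (D ξ) t y z i j)) ∧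
        ∃ (R₁ R₂ : ℝ → ℝ → ℝ → Matrix (Fin 2) (Fin 2) ℂ),
          -- decomposition, for every contour of the family
          (∀ (p : ℝ), (D ξ).trace < p → ∀ (t : ℝ), 0 < t → ∀ (y z : ℝ), 0 ≤ y → 0 ≤ z →
            StokesGreen.residualKernel ν (StokesGreen.freqNorm ξ) p (D ξ) t y z
              = R₁ t y z + R₂ t y z) ∧
          StokesGreen.SmoothInZ R₁ ∧ StokesGreen.SmoothInZ R₂ ∧
          -- the boundary-layer part
          (∀ (k : ℕ) (T t y z : ℝ), 0 < t →
            (t ≤ T ∨ 1 ≤ ν * StokesGreen.freqNorm ξ ^ 2) → 0 ≤ y → 0 ≤ z → ∀ (i j : Fin 2),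
            ‖StokesGreen.dz k R₁ i j t y z‖ ≤
              C₁ k T * StokesGreen.muZero ν (StokesGreen.freqNorm ξ) ^ (k + 1)
                * Real.exp (-θ₀ * StokesGreen.muZero ν (StokesGreen.freqNorm ξ) * (y + z))
                * Real.exp (ν * ((D ξ).trace ^ 2 - StokesGreen.freqNorm ξ ^ 2) * t)) ∧
          -- the Gaussian part
          (∀ (k : ℕ) (c t y z : ℝ), 0 < c → (c < 1 / 4 ∨ (c = 1 / 4 ∧ k = 0)) →
            0 < t → 0 ≤ y → 0 ≤ z → ∀ (i j : Fin 2),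
            ‖StokesGreen.dz k R₂ i j t y z‖ ≤
              C₂ k c * (1 / (ν * t) ^ (((k : ℝ) + 1) / 2))
                * Real.exp (-c * ((y + z) ^ 2 / (ν * t)))
                * Real.exp (-(ν * StokesGreen.freqNorm ξ ^ 2 * t) / 8)) := by
  choose Nₑ hNₑ hexp using StokesGreen.exists_iteratedDeriv_profile_le_exp
  choose! N hN hgauss using StokesGreen.exists_iteratedDeriv_profile_le_gaussian
  -- The value `1/8` is the Gaussian rate chosen for the boundary layer, below `1/4` so that it
  -- serves every `k`.
  refine ⟨1 / 8, by norm_num, fun C₀ hC => ⟨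
    fun k T => 2 * (Nₑ k + N k (1 / 8)) * 2 ^ k * C₀ ^ (k + 1) * Real.exp |T|,
    fun k c => 2 * N k c *
      ((1 + C₀) ^ (k + 1) * ((k + 1).factorial * Real.exp 2) * Real.exp 1),
    fun D hD ν hν ξ => ?_⟩⟩
  have hs := StokesGreen.freqNorm_nonneg ξ
  have ha := hD.trace_nonneg ξ
  have has := hD.trace_le ξ
  have hent := hD.abs_entry_le_trace ξ
  set s := StokesGreen.freqNorm ξ
  set S := StokesGreen.gaussianTimes ν s (D ξ).trace
  have hμ : 0 ≤ StokesGreen.muZero ν s := by unfold StokesGreen.muZero; positivity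
  have h8 : ∀ k : ℕ, (1 / 8 : ℝ) < 1 / 4 ∨ ((1 / 8 : ℝ) = 1 / 4 ∧ k = 0) :=
    fun _ => Or.inl (by norm_num)
  refine ⟨fun p hp t ht y z hy hz i j =>
      StokesGreen.integrable_residualIntegrand hν s ha hp ht hy hz i j,
    StokesGreen.timePart Sᶜ ν s (D ξ), StokesGreen.timePart S ν s (D ξ),
    fun p hp t ht y z hy hz => ?_, StokesGreen.smoothInZ_timePart _ _ _ _,
    StokesGreen.smoothInZ_timePart _ _ _ _, fun k T t y z ht hT hy hz i j => ?_,
    fun k c t y z _ hc ht hy hz i j => ?_⟩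
  · rw [StokesGreen.timePart_compl_add,
      StokesGreen.residualKernel_eq_closedForm hν s ha hp ht hy hz]
  · by_cases hmem : t ∈ S
    · rw [StokesGreen.dz_timePart_of_notMem (by simpa using hmem), norm_zero]
      have := hNₑ k
      have := hN k (1 / 8) (h8 k)
      positivity
    · rw [StokesGreen.dz_timePart_of_mem hmem]
      exact StokesGreen.norm_dz_le_boundaryLayer hC (hNₑ k) (hN k _ (h8 k)) (hexp k)
        (hgauss k _ (h8 k)) hν hs ha has (hent i j) ht hmem hT hy hz
  · by_cases hmem : t ∈ S
    · rw [StokesGreen.dz_timePart_of_mem hmem]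
      exact StokesGreen.norm_dz_le_gaussian hC (hN k c hc) (hgauss k c hc) hν hs ha has
        (hent i j) ht hmem hy hz
    · rw [StokesGreen.dz_timePart_of_notMem hmem, norm_zero]
      have := hN k c hc
      positivity
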